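/- A continuum is a nonempty compact connected metrizable space. For a point $x$ of a space $X$, let $\mathrm{ord}(x,X)$ be the least cardinal $\kappa$ such that $x$ has arbitrarily small open neighbourhoods with boundary of cardinality at most $\kappa$. A continuum $G$ is a tame graph if the set of points $x$ with $\mathrm{ord}(x,G)=1$ or $\mathrm{ord}(x,G)\ge 3$ has countable closure. A free arc in $G$ is a set $\alpha\subset G$ homeomorphic to $[0,1]$ such that $\alpha^\circ:=\alpha\setminus\{\text{endpoints of }\alpha\}$ is open in $G$. A countable Markov partition for $f\colon G\to G$ is a countable family $\mathcal P$ of free arcs with pairwise disjoint interiors $i^\circ$, covering $G$ up to a countable set, such that $f$ maps each $i\in\mathcal P$ homeomorphically onto $f(i)$, and $f(i)\supset j$ whenever $i,j\in\mathcal P$ and $f(i)\cap j^\circ\ne\emptyset$. The class $\mathcal{CPM}(G)$ consists of the continuous maps $f\colon G\to G$ that admit a countably infinite Markov partition and are topologically mixing (for all nonempty open $U,V$ there is $n$ with $f^m(U)\cap V\neq\emptyset$ for all $m\ge n$). The transition matrix $M=(m_{ij})_{i,j\in\mathcal P}$ has $m_{ij}=1$ if $f(i)\supset j$ and $m_{ij}=0$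 otherwise; $\Sigma_M=\{i_0i_1\cdots\in\mathcal P^{\mathbb N_0}: m_{i_ni_{n+1}}=1\text{ for all }n\}$ carries the topology inherited from the product of discrete spaces, and $\sigma$ is the shift map on it. In a measurable dynamical system $(X,T)$, a measurable set $N\subset X$ is small if $T^{-1}(N)\subset N$ and every $T$-invariant probability measure concentrated on $N$ has (Kolmogorov--Sinai) entropy $0$. Systems $(X,T)$ and $(X',T')$ are isomorphic modulo small sets if there are small sets $N\subset X$, $N'\subset X'$ and a bimeasurable bijection $\psi\colon X\setminus N\to X'\setminus N'$ with $T'\circ\psi=\psi\circ T$ on $X\setminus N$. **Theorem.** Let $G$ be a tame graph, let $f\in\mathcal{CPM}(G)$, and let $\mathcal P$ be a countable Markov partition for $f$, with transition matrix $M$. Then, with respect to the Borel $\sigma$-algebras, $(G,f)$ and $(\Sigma_M,\sigma)$ are isomorphic modulo small sets. More precisely, for every $i_0i_1\cdots\in\Sigma_M$ the set $\bigcap_{n\ge0}\,\bigl(i_0\cap f^{-1}(i_1)\cap\cdots\cap f^{-n}(i_n)\bigr)$ consists of a single point $\psi(i_0i_1\cdots)$; the sets $Q=\bigcup_{n\ge0}f^{-n}\bigl(G\setminus\bigcup_{i\in\mathcal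 P}i^\circ\bigr)\subset G$ and $N=\psi^{-1}(Q)\subset\Sigma_M$ are countable and small; and $\psi$ restricts to a bimeasurable bijection $\Sigma_M\setminus N\to G\setminus Q$ with $f\circ\psi=\psi\circ\sigma$ on $\Sigma_M\setminus N$. -/

import Mathlib

open Set Filter Topology MeasureTheory

universe u v

namespace TameGraph

section Continua

variable {X : Type u} [TopologicalSpace X]

/-- The order `ord(x, X)` of a point `x` of a space `X`: the least cardinal `κ` such that `x` has
arbitrarily small open neighbourhoods whose boundary has at most `κ` points. -/
noncomputable def pointOrder (x : X) : Cardinal.{u} :=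
  sInf {κ | ∀ U : Set X, IsOpen U → x ∈ U →
    ∃ V : Set X, IsOpen V ∧ x ∈ V ∧ V ⊆ U ∧ Cardinal.mk (frontier V) ≤ κ}

variable (X) in
/-- The set `E(X)` of endpoints of a space. -/
def endpoints : Set X := {x | pointOrder x = 1}

variable (X) in
/-- The set `B(X)` of branchpoints of a space. -/
def branchpoints : Set X := {x | 3 ≤ pointOrder x}

variable (X) in
/-- A tame graph: a continuum (nonempty compact connected metrizable space) in which the set of
endpoints and branchpoints has a countable closure. -/
structure IsTameGraph : Prop where
  compact : CompactSpace X
  connected : ConnectedSpace X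
  metrizable : TopologicalSpace.MetrizableSpace X
  countable_closure : (closure (endpoints X ∪ branchpoints X)).Countable

/-- An arc: a homeomorphic copy of `[0, 1]`. -/
def IsArc (α : Set X) : Prop :=
  ∃ γ : unitInterval → X, IsEmbedding γ ∧ range γ = α

/-- The two endpoints `E(α)` of an arc `α`, i.e. the points at which some parametrization
starts (every arc can be parametrized starting from either end). -/
def arcEnds (α : Set X) : Set X :=
  {x | ∃ γ : unitInterval → X, IsEmbedding γ ∧ range γ = α ∧ γ 0 = x}

/-- The interior `α° = α \ E(α)` of an arc. -/
def arcInterior (α : Set X) : Set X := α \ arcEnds α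

/-- A free arc. -/
def IsFreeArc (α : Set X) : Prop := IsArc α ∧ IsOpen (arcInterior α)

/-- A tame partition: countably many free arcs with pairwise disjoint interiors, covering the
space up to a countable set. -/
structure IsTamePartition (P : Set (Set X)) : Prop where
  countable : P.Countable
  freeArc : ∀ i ∈ P, IsFreeArc i
  disjoint : ∀ i ∈ P, ∀ j ∈ P, i ≠ j → Disjoint (arcInterior i) (arcInterior j)
  cover : (⋃₀ P)ᶜ.Countable

/-- A countable Markov partition for `f`. -/
structure IsMarkovPartition (f : X → X) (P : Set (Set X)) : Prop where
  tame : IsTamePartition P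
  monotone : ∀ i ∈ P, IsEmbedding (i.domRestrict f)
  markov : ∀ i ∈ P, ∀ j ∈ P, (f '' i ∩ arcInterior j).Nonempty → j ⊆ f '' i

/-- Topological mixing. -/
def IsTopMixing (f : X → X) : Prop :=
  ∀ U V : Set X, IsOpen U → U.Nonempty → IsOpen V → V.Nonempty →
    ∃ n : ℕ, ∀ m ≥ n, (f^[m] '' U ∩ V).Nonempty

/-- The class of countably Markov and mixing maps. -/
structure IsCPM (f : X → X) : Prop where
  continuous : Continuous f
  exists_partition : ∃ P : Set (Set X), P.Infinite ∧ IsMarkovPartition f P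
  mixing : IsTopMixing f

/-- The complement of the union of the interiors of the partition arcs. -/
def partitionPoints (P : Set (Set X)) : Set X := (⋃ i ∈ P, arcInterior i)ᶜ

/-- The set `Q` of all points that some iterate of `f` sends to the set of partition points. -/
def exceptionalSet (f : X → X) (P : Set (Set X)) : Set X :=
  ⋃ n : ℕ, f^[n] ⁻¹' partitionPoints P

open Classical in
/-- The transition matrix `M` of `f` with respect to a partition. -/
noncomputable def transitionMatrix (f : X → X) (P : Set (Set X)) : Matrix P P ℕ :=
  fun i j => if (j : Set X) ⊆ f '' (i : Set X) then 1 else 0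

end Continua

section MarkovShift

variable {ι : Type v}

/-- The space `Σ_M` of all one-sided sequences whose transitions are allowed by `M`. -/
def MarkovShift (M : Matrix ι ι ℕ) : Type v :=
  {s : ℕ → ι // ∀ n, M (s n) (s (n + 1)) = 1}

/-- The topology of `Σ_M` is inherited from the product of discrete spaces. It is spelled out
because the index type may carry an unrelated topology. -/
instance (M : Matrix ι ι ℕ) : TopologicalSpace (MarkovShift M) :=
  TopologicalSpace.induced (fun s : MarkovShift M => s.1)
    (@Pi.topologicalSpace ℕ (fun _ => ι) (fun _ => ⊥))

instance (M : Matrix ι ι ℕ) : MeasurableSpace (MarkovShift M) := borel _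

instance (M : Matrix ι ι ℕ) : BorelSpace (MarkovShift M) := ⟨rfl⟩

/-- The shift map. -/
def MarkovShift.shift (M : Matrix ι ι ℕ) (s : MarkovShift M) : MarkovShift M :=
  ⟨fun n => s.1 (n + 1), fun n => s.2 (n + 1)⟩

end MarkovShift

/-- The set `[i₀ i₁ ⋯ iₙ] = i₀ ∩ f⁻¹ i₁ ∩ ⋯ ∩ f⁻ⁿ iₙ`. -/
def cylinder {X : Type u} (f : X → X) (i : ℕ → Set X) (n : ℕ) : Set X :=
  ⋂ k ≤ n, f^[k] ⁻¹' i k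

section Entropy

variable {X : Type u} [MeasurableSpace X]

/-- The Shannon entropy of the join `ξ ∨ T⁻¹ξ ∨ ⋯ ∨ T⁻⁽ⁿ⁻¹⁾ξ`, where a finite partition is given
by its labelling function `ξ`. -/
noncomputable def blockEntropy (μ : Measure X) (T : X → X) {k : ℕ} (ξ : X → Fin k) (n : ℕ) : ℝ :=
  ∑ w : Fin n → Fin k, Real.negMulLog (μ.real {x | ∀ j : Fin n, ξ (T^[(j : ℕ)] x) = w j})

/-- The Kolmogorov-Sinai entropy `h_μ(T)`: the supremum over all finite measurable partitions `ξ`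
of `lim (1/n) H_μ(ξ ∨ ⋯ ∨ T⁻⁽ⁿ⁻¹⁾ξ)`. -/
noncomputable def measureEntropy (μ : Measure X) (T : X → X) : ENNReal :=
  ⨆ (k : ℕ) (ξ : X → Fin k) (_ : Measurable ξ),
    limsup (fun n : ℕ => ENNReal.ofReal (blockEntropy μ T ξ n / n)) atTop

/-- A small set of a measurable dynamical system. -/
structure IsSmall (T : X → X) (N : Set X) : Prop where
  measurable : MeasurableSet N
  backward : T ⁻¹' N ⊆ N
  entropy : ∀ μ : Measure X, IsProbabilityMeasure μ → MeasurePreserving T μ μ → μ Nᶜ = 0 →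
    measureEntropy μ T = 0

variable {Y : Type v} [MeasurableSpace Y]

/-- The bimeasurable bijection `e : X \ N → Y \ N'` is an isomorphism modulo the small sets
`N`, `N'`. The intertwining relation `S ∘ e = e ∘ T` makes sense since `T` maps the complement of
the backward invariant set `N` into itself; below `y` stands for `T x`. -/
structure IsIsoModSmall (T : X → X) (S : Y → Y) (N : Set X) (N' : Set Y)
    (e : ↥(Nᶜ) ≃ᵐ ↥(N'ᶜ)) : Prop where
  small_source : IsSmall T N
  small_target : IsSmall S N'
  intertwine : ∀ x y : ↥(Nᶜ), (y : X) = T x → S (e x) = e y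

/-- Two measurable dynamical systems are isomorphic modulo small sets. -/
def IsomorphicModSmallSets (T : X → X) (S : Y → Y) : Prop :=
  ∃ (N : Set X) (N' : Set Y) (e : ↥(Nᶜ) ≃ᵐ ↥(N'ᶜ)), IsIsoModSmall T S N N' e

end Entropy

end TameGraph

/-! A sequence codes a nested intersection of cylinders. Each cylinder is compact and connected,
since `f` restricted to an arc is a homeomorphism onto its image (`isConnected_cylinder`), so only
uniqueness of the coded point is at stake. Two points in the intersection would span an open
interval whose `m`-th image lies in the single arc `i m`. By mixing that image eventually meets
every partition interior, so `i m` would have to equal every arc of `P` for large `m`. This is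
absurd because `P` has at least two arcs (`IsMarkovPartition.nontrivial`).

Off `Q` the itinerary is unique and depends continuously on the point, so the coding is even a
homeomorphism there (`exists_coding_homeomorph`). `Q` is countable because `f` has countable fibres.
Over a point of `Q`, once the orbit hits an arc end it remains at ends of the coding arcs, and the
later symbols are forced; hence the fibre is countable (`countable_coding_preimage_singleton`).
Countable sets carry no entropy (`measureEntropy_eq_zero_of_countable`), so both exceptional sets
are small. -/

namespace TameGraph

/-! ### Zero entropy of measures carried by countable sets -/

section Entropy

theorem negMulLog_le_one {x : ℝ} (hx : 0 ≤ x) : Real.negMulLog x ≤ 1 := by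
  rcases hx.eq_or_lt with rfl | h
  · simp
  · have := mul_le_mul_of_nonneg_left (Real.one_sub_inv_le_log_of_pos h) hx
    rw [mul_sub, mul_inv_cancel₀ h.ne'] at this
    simp only [Real.negMulLog]
    linarith

/-- Jensen with uniform weights, the total mass being allowed to differ from 1; the resulting term
`negMulLog` of the total mass is at most 1. -/
theorem sum_negMulLog_le {ι : Type*} (A : Finset ι) (p : ι → ℝ) (hp : ∀ i ∈ A, 0 ≤ p i) :
    ∑ i ∈ A, Real.negMulLog (p i) ≤ 1 + (∑ i ∈ A, p i) * Real.log A.card := by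
  rcases A.eq_empty_or_nonempty with rfl | hA
  · simp
  have hc : (0 : ℝ) < A.card := by exact_mod_cast hA.card_pos
  have hS : 0 ≤ ∑ i ∈ A, p i := Finset.sum_nonneg hp
  have hJ := Real.concaveOn_negMulLog.le_map_sum (t := A) (w := fun _ => (A.card : ℝ)⁻¹) (p := p)
    (fun _ _ => by positivity) (by simp [hc.ne']) hp
  simp only [smul_eq_mul, ← Finset.mul_sum] at hJ
  rw [Real.negMulLog_mul] at hJ
  have hJ' := mul_le_mul_of_nonneg_left hJ hc.le
  have h1 := negMulLog_le_one hS
  have e1 : (A.card : ℝ) * ((A.card : ℝ)⁻¹ * ∑ i ∈ A, Real.negMulLog (p i)) =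
      ∑ i ∈ A, Real.negMulLog (p i) := by field_simp
  have e2 : (A.card : ℝ) * ((∑ i ∈ A, p i) * Real.negMulLog (A.card : ℝ)⁻¹ +
      (A.card : ℝ)⁻¹ * Real.negMulLog (∑ i ∈ A, p i)) =
      (∑ i ∈ A, p i) * Real.log A.card + Real.negMulLog (∑ i ∈ A, p i) := by
    simp only [Real.negMulLog, Real.log_inv]; field_simp
  linarith

variable {X : Type*} [MeasurableSpace X]

/-- Words read along orbits starting in `F` number at most `F.card`, independently of `n`. The other
words, at most `k ^ n` of them, share mass at most `ε`. -/
theorem blockEntropy_le {μ : Measure X} [IsProbabilityMeasure μ] {T : X → X} (hT : Measurable T)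
    {k : ℕ} {ξ : X → Fin k} (hξ : Measurable ξ) (F : Finset X) {ε : ℝ}
    (hF : 1 - ε ≤ μ.real F) (n : ℕ) :
    blockEntropy μ T ξ n ≤ (2 + Real.log F.card) + ε * (n * Real.log k) := by
  classical
  set word : X → Fin n → Fin k := fun x j => ξ (T^[(j : ℕ)] x) with hword
  have hwm : Measurable word := measurable_pi_lambda _ fun j => hξ.comp (hT.iterate _)
  have hset : ∀ w : Fin n → Fin k, {x | ∀ j : Fin n, ξ (T^[(j : ℕ)] x) = w j} = word ⁻¹' {w} := by
    intro w; ext x; simp [hword, funext_iff]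
  have hsum : ∀ A : Finset (Fin n → Fin k), ∑ w ∈ A, μ.real (word ⁻¹' {w}) = μ.real (word ⁻¹' A) :=
    fun A => sum_measureReal_preimage_singleton A fun w _ => hwm (measurableSet_singleton w)
  set A : Finset (Fin n → Fin k) := F.image word
  have hlogk : 0 ≤ Real.log k := Real.log_natCast_nonneg k
  have hA : 1 - ε ≤ μ.real (word ⁻¹' A) :=
    hF.trans (measureReal_mono fun x hx =>
      Finset.mem_coe.2 (Finset.mem_image_of_mem word (Finset.mem_coe.1 hx)))
  have hAc : μ.real (word ⁻¹' (Aᶜ : Finset _)) ≤ ε := by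
    rw [Finset.coe_compl, preimage_compl, probReal_compl_eq_one_sub (hwm A.measurableSet)]
    linarith
  have b1 := sum_negMulLog_le A (fun w => μ.real (word ⁻¹' {w})) fun _ _ => measureReal_nonneg
  have b2 := sum_negMulLog_le Aᶜ (fun w => μ.real (word ⁻¹' {w})) fun _ _ => measureReal_nonneg
  rw [hsum] at b1 b2
  have l1 : Real.log A.card ≤ Real.log F.card := by
    rcases A.card.eq_zero_or_pos with h | h
    · rw [h]; simpa using Real.log_natCast_nonneg _
    · exact Real.log_le_log (by exact_mod_cast h) (by exact_mod_cast Finset.card_image_le)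
  have l2 : Real.log (Aᶜ).card ≤ n * Real.log k := by
    rcases (Aᶜ).card.eq_zero_or_pos with h | h
    · rw [h]; simpa using mul_nonneg n.cast_nonneg hlogk
    · rw [← Real.log_pow]
      refine Real.log_le_log (by exact_mod_cast h) ?_
      have := Finset.card_le_univ Aᶜ
      simp only [Fintype.card_pi, Fintype.card_fin, Finset.prod_const, Finset.card_univ] at this
      exact_mod_cast this
  have c1 : μ.real (word ⁻¹' A) * Real.log A.card ≤ Real.log F.card :=
    (mul_le_of_le_one_left (Real.log_natCast_nonneg _) measureReal_le_one).trans l1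
  have c2 : μ.real (word ⁻¹' (Aᶜ : Finset _)) * Real.log (Aᶜ).card ≤ ε * (n * Real.log k) :=
    (mul_le_mul_of_nonneg_left l2 measureReal_nonneg).trans
      (mul_le_mul_of_nonneg_right hAc (mul_nonneg n.cast_nonneg hlogk))
  have : blockEntropy μ T ξ n = ∑ w ∈ A, Real.negMulLog (μ.real (word ⁻¹' {w})) +
      ∑ w ∈ Aᶜ, Real.negMulLog (μ.real (word ⁻¹' {w})) := by
    rw [Finset.sum_add_sum_compl]
    simp only [blockEntropy, hset]
  linarith

theorem exists_finset_measureReal_ge {μ : Measure X} [IsProbabilityMeasure μ] {N : Set X}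
    (hN : N.Countable) (hμ : μ Nᶜ = 0) {ε : ℝ} (hε : 0 < ε) :
    ∃ F : Finset X, 1 - ε ≤ μ.real F := by
  have hN1 : μ N = 1 := by
    rw [measure_of_measure_compl_eq_zero hμ, measure_univ]
  obtain ⟨x₀, hx₀⟩ : N.Nonempty := by
    rw [nonempty_iff_ne_empty]; rintro rfl; simp at hN1
  obtain ⟨g, rfl⟩ := hN.exists_eq_range ⟨x₀, hx₀⟩
  classical
  have hmono : Monotone fun n : ℕ => (((Finset.range n).image g : Finset X) : Set X) := by
    intro m n h
    simp only [Finset.coe_image]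
    exact image_mono (by simpa using h)
  have hU : ⋃ n : ℕ, (((Finset.range n).image g : Finset X) : Set X) = range g := by
    ext y
    simp only [mem_iUnion, Finset.coe_image, mem_image, Finset.coe_range, mem_Iio, mem_range]
    exact ⟨fun ⟨_, m, _, h⟩ => ⟨m, h⟩, fun ⟨m, h⟩ => ⟨m + 1, m, m.lt_succ_self, h⟩⟩
  have ht := tendsto_measure_iUnion_atTop (μ := μ) hmono
  rw [hU, hN1] at ht
  have ht' := (ENNReal.tendsto_toReal ENNReal.one_ne_top).comp ht
  obtain ⟨n, hn⟩ := (ht'.eventually (lt_mem_nhds (a := 1 - ε) (by simpa using hε))).exists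
  exact ⟨_, hn.le⟩

theorem measureEntropy_eq_zero_of_countable {μ : Measure X} [IsProbabilityMeasure μ] {T : X → X}
    (hT : Measurable T) {N : Set X} (hN : N.Countable) (hμ : μ Nᶜ = 0) :
    measureEntropy μ T = 0 := by
  simp only [measureEntropy, ← bot_eq_zero, iSup_eq_bot]
  intro k ξ hξ
  rw [bot_eq_zero, ← nonpos_iff_eq_zero]
  refine ENNReal.le_of_forall_pos_le_add fun δ hδ _ => ?_
  rw [zero_add]
  have hδ' : (0 : ℝ) < δ := hδ
  have hlogk : 0 ≤ Real.log k := Real.log_natCast_nonneg k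
  -- The `+ 1` keeps the denominator positive when `log k = 0`.
  set ε : ℝ := δ / (2 * (Real.log k + 1)) with hε
  obtain ⟨F, hF⟩ := exists_finset_measureReal_ge hN hμ (ε := ε) (by positivity)
  have hεk : ε * Real.log k ≤ δ / 2 := by
    rw [hε, div_mul_eq_mul_div, div_le_div_iff₀ (by positivity) two_pos]
    nlinarith
  have hC := tendsto_const_div_atTop_nhds_zero_nat (2 + Real.log F.card)
  refine limsup_le_of_le (by isBoundedDefault) ?_
  filter_upwards [hC.eventually (gt_mem_nhds (half_pos hδ')), eventually_gt_atTop 0] with n h1 hn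
  rw [← ENNReal.ofReal_coe_nnreal]
  refine ENNReal.ofReal_le_ofReal ?_
  have hn' : (0 : ℝ) < n := by exact_mod_cast hn
  have := div_le_div_of_nonneg_right (blockEntropy_le hT hξ F hF n) hn'.le
  rw [add_div, show ε * (n * Real.log k) / n = ε * Real.log k by field_simp] at this
  linarith

theorem isSmall_of_countable {T : X → X} {N : Set X} (hm : MeasurableSet N) (hN : N.Countable)
    (hT : T ⁻¹' N ⊆ N) : IsSmall T N where
  measurable := hm
  backward := hT
  entropy _ _ hμ h := measureEntropy_eq_zero_of_countable hμ.measurable hN h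

end Entropy

/-! ### Arcs, their ends, and tame partitions -/

section Arcs

variable {X : Type*} [TopologicalSpace X]

/-- Reduces comparison of nested arcs to injective continuous self-maps of the interval, which are
strictly monotone. -/
theorem exists_lift_of_isEmbedding {a b : unitInterval → X} (ha : IsEmbedding a)
    (hb : IsEmbedding b) (hab : range b ⊆ range a) :
    ∃ h : unitInterval → unitInterval, Continuous h ∧ Function.Injective h ∧ ∀ t, a (h t) = b t := by
  choose h hh using fun t => hab (mem_range_self t)
  refine ⟨h, ha.continuous_iff.2 ?_, fun s t hst => hb.injective ?_, hh⟩
  · simpa only [Function.comp_def, hh] using hb.continuous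
  · rw [← hh s, ← hh t, hst]

theorem eq_zero_or_one_of_apply_eq_zero {h : unitInterval → unitInterval} (hc : Continuous h)
    (hi : Function.Injective h) {t : unitInterval} (ht : h t = 0) : t = 0 ∨ t = 1 := by
  rcases hc.strictMono_of_inj hi with hm | hm
  · left
    exact le_antisymm (hm.le_iff_le.1 (ht.trans_le unitInterval.nonneg')) unitInterval.nonneg'
  · right
    exact le_antisymm unitInterval.le_one' (hm.le_iff_ge.1 (ht.trans_le unitInterval.nonneg'))

theorem arcEnds_range {γ : unitInterval → X} (hγ : IsEmbedding γ) :
    arcEnds (range γ) = {γ 0, γ 1} := by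
  ext x
  constructor
  · rintro ⟨δ, hδ, hr, rfl⟩
    obtain ⟨h, hc, hi, hh⟩ := exists_lift_of_isEmbedding hδ hγ hr.ge
    obtain ⟨t, ht⟩ : δ 0 ∈ range γ := hr ▸ mem_range_self 0
    rcases eq_zero_or_one_of_apply_eq_zero hc hi (hδ.injective ((hh t).trans ht)) with rfl | rfl
    · exact Or.inl ht.symm
    · exact Or.inr ht.symm
  · rintro (rfl | rfl)
    · exact ⟨γ, hγ, rfl, rfl⟩
    · exact ⟨γ ∘ unitInterval.symmHomeomorph, hγ.comp unitInterval.symmHomeomorph.isEmbedding,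
        unitInterval.symmHomeomorph.surjective.range_comp γ, by simp⟩

theorem arcInterior_range {γ : unitInterval → X} (hγ : IsEmbedding γ) :
    arcInterior (range γ) = γ '' Ioo 0 1 := by
  rw [arcInterior, arcEnds_range hγ, ← image_pair, ← image_univ, ← image_sdiff hγ.injective]
  congr 1
  ext t
  simp only [Set.mem_sdiff, mem_univ, true_and, mem_insert_iff, mem_singleton_iff, not_or, mem_Ioo,
    unitInterval.pos_iff_ne_zero, unitInterval.lt_one_iff_ne_one]

variable {α j : Set X}

theorem IsArc.isCompact (h : IsArc α) : IsCompact α := by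
  obtain ⟨γ, hγ, rfl⟩ := h
  exact isCompact_range hγ.continuous

theorem IsArc.isConnected (h : IsArc α) : IsConnected α := by
  obtain ⟨γ, hγ, rfl⟩ := h
  exact isConnected_range hγ.continuous

theorem IsArc.finite_arcEnds (h : IsArc α) : (arcEnds α).Finite := by
  obtain ⟨γ, hγ, rfl⟩ := h
  rw [arcEnds_range hγ]
  exact toFinite _

theorem IsArc.subset_closure_arcInterior (h : IsArc α) : α ⊆ closure (arcInterior α) := by
  obtain ⟨γ, hγ, rfl⟩ := h
  rw [arcInterior_range hγ]
  refine Subset.trans ?_ (image_closure_subset_closure_image hγ.continuous)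
  rw [closure_Ioo zero_ne_one, ← image_univ]
  exact image_mono fun t _ => ⟨unitInterval.nonneg', unitInterval.le_one'⟩

theorem IsArc.nonempty_arcInterior (h : IsArc α) : (arcInterior α).Nonempty :=
  closure_nonempty_iff.1 (h.isConnected.nonempty.mono h.subset_closure_arcInterior)

theorem mem_arcEnds_of_subset {p : X} (hp : p ∈ arcEnds α) (hj : IsArc j) (hjα : j ⊆ α)
    (hpj : p ∈ j) : p ∈ arcEnds j := by
  obtain ⟨a, ha, rfl, rfl⟩ := hp
  obtain ⟨b, hb, rfl⟩ := hj
  obtain ⟨h, hc, hi, hh⟩ := exists_lift_of_isEmbedding ha hb hjα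
  obtain ⟨t, ht⟩ := hpj
  rw [arcEnds_range hb]
  rcases eq_zero_or_one_of_apply_eq_zero hc hi (ha.injective ((hh t).trans ht)) with rfl | rfl
  · exact Or.inl ht.symm
  · exact Or.inr ht.symm

/-- Two arcs in an arc that share one of its endpoints have infinitely many common points. -/
theorem infinite_inter_of_mem_arcEnds {k : Set X} {p : X} (hp : p ∈ arcEnds α) (hj : IsArc j)
    (hk : IsArc k) (hjα : j ⊆ α) (hkα : k ⊆ α) (hpj : p ∈ j) (hpk : p ∈ k) :
    (j ∩ k).Infinite := by
  obtain ⟨a, ha, rfl, rfl⟩ := hp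
  have key : ∀ l : Set X, IsArc l → l ⊆ range a → a 0 ∈ l → ∃ t > 0, Icc 0 t ⊆ a ⁻¹' l := by
    intro l hl hla h0
    have hc : IsPreconnected (a ⁻¹' l) := by
      rw [← ha.isInducing.isPreconnected_image, image_preimage_eq_of_subset hla]
      exact hl.isConnected.isPreconnected
    obtain ⟨b, hb, rfl⟩ := hl
    obtain ⟨x, hx, hx0⟩ : ∃ x ∈ range b, x ≠ a 0 := by
      by_contra! H
      exact zero_ne_one (hb.injective ((H _ (mem_range_self 0)).trans (H _ (mem_range_self 1)).symm))
    obtain ⟨t, rfl⟩ := hla hx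
    exact ⟨t, unitInterval.pos_iff_ne_zero.2 fun h => hx0 (h ▸ rfl), hc.Icc_subset h0 hx⟩
  obtain ⟨s, hs, hsj⟩ := key j hj hjα hpj
  obtain ⟨t, ht, htk⟩ := key k hk hkα hpk
  refine ((Icc_infinite (lt_min hs ht)).image ha.injective.injOn).mono ?_
  rintro _ ⟨u, hu, rfl⟩
  exact ⟨hsj ⟨hu.1, hu.2.trans (min_le_left _ _)⟩, htk ⟨hu.1, hu.2.trans (min_le_right _ _)⟩⟩

theorem image_arcEnds {Y : Type*} [TopologicalSpace Y] {f : X → Y}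
    (hf : IsEmbedding (α.domRestrict f)) {p : X} (hp : p ∈ arcEnds α) :
    f p ∈ arcEnds (f '' α) := by
  obtain ⟨γ, hγ, rfl, rfl⟩ := hp
  refine ⟨f ∘ γ, hf.comp (hγ.codRestrict _ mem_range_self), range_comp f γ, rfl⟩

variable {P : Set (Set X)}

theorem IsTamePartition.isArc (hP : IsTamePartition P) (hj : j ∈ P) : IsArc j :=
  (hP.freeArc j hj).1

/-- Since the interior of `j` is open, disjointness from the interior of `i` passes to its closure,
which contains `i`. -/
theorem IsTamePartition.disjoint_arcInterior (hP : IsTamePartition P) {i : Set X} (hi : i ∈ P)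
    (hj : j ∈ P) (hij : i ≠ j) : Disjoint i (arcInterior j) :=
  ((hP.disjoint i hi j hj hij).closure_left (hP.freeArc j hj).2).mono_left
    (hP.isArc hi).subset_closure_arcInterior

theorem IsTamePartition.eq_of_mem_arcInterior (hP : IsTamePartition P) {i : Set X} (hi : i ∈ P)
    (hj : j ∈ P) {x : X} (hxi : x ∈ i) (hxj : x ∈ arcInterior j) : i = j := by
  by_contra h
  exact disjoint_left.1 (hP.disjoint_arcInterior hi hj h) hxi hxj

/-- Distinct partition arcs meet only in the finitely many ends of `j`, whereas two subarcs at a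
common end of `α` overlap in infinitely many points. -/
theorem IsTamePartition.eq_of_mem_arcEnds (hP : IsTamePartition P) {i : Set X} (hi : i ∈ P)
    (hj : j ∈ P) {p : X} (hp : p ∈ arcEnds α) (hiα : i ⊆ α) (hjα : j ⊆ α) (hpi : p ∈ i)
    (hpj : p ∈ j) : i = j := by
  by_contra h
  refine infinite_inter_of_mem_arcEnds hp (hP.isArc hi) (hP.isArc hj) hiα hjα hpi hpj
    ((hP.isArc hj).finite_arcEnds.subset fun x hx => ?_)
  by_contra hx'
  exact disjoint_left.1 (hP.disjoint_arcInterior hi hj h) hx.1 ⟨hx.2, hx'⟩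

theorem IsTamePartition.countable_partitionPoints (hP : IsTamePartition P) :
    (partitionPoints P).Countable := by
  refine (hP.cover.union (hP.countable.biUnion fun i hi =>
    (hP.isArc hi).finite_arcEnds.countable)).mono fun x hx => ?_
  simp only [partitionPoints, mem_compl_iff, mem_iUnion, not_exists] at hx
  by_cases h : x ∈ ⋃₀ P
  · obtain ⟨i, hi, hxi⟩ := h
    refine Or.inr (mem_biUnion hi ?_)
    by_contra h'
    exact hx i hi ⟨hxi, h'⟩
  · exact Or.inl h

theorem IsMarkovPartition.countable_preimage {f : X → X} (hP : IsMarkovPartition f P) {S : Set X}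
    (hS : S.Countable) : (f ⁻¹' S).Countable := by
  refine (hP.tame.cover.union (hP.tame.countable.biUnion fun i hi =>
    (?_ : (i ∩ f ⁻¹' S).Countable))).mono fun x hx => ?_
  · refine MapsTo.countable_of_injOn (f := f) (fun x hx => hx.2) ?_ hS
    exact (injOn_iff_injective.2 (hP.monotone i hi).injective).mono inter_subset_left
  · by_cases h : x ∈ ⋃₀ P
    · obtain ⟨i, hi, hxi⟩ := h
      exact Or.inr (mem_biUnion hi ⟨hxi, hx⟩)
    · exact Or.inl h

theorem IsMarkovPartition.countable_exceptionalSet {f : X → X} (hP : IsMarkovPartition f P) :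
    (exceptionalSet f P).Countable := by
  refine countable_iUnion fun n => ?_
  induction n with
  | zero => exact hP.tame.countable_partitionPoints
  | succ n ih =>
    rw [Function.iterate_succ, preimage_comp]
    exact hP.countable_preimage ih

end Arcs

/-! ### Cylinder sets -/

section Cylinders

variable {X : Type*} {f : X → X}

theorem cylinder_succ (f : X → X) (i : ℕ → Set X) (n : ℕ) :
    cylinder f i (n + 1) = i 0 ∩ f ⁻¹' cylinder f (fun k => i (k + 1)) n := by
  ext x
  simp only [cylinder, mem_iInter, mem_preimage, mem_inter_iff]
  constructor
  · exact fun h => ⟨h 0 (Nat.zero_le _), fun k hk => h (k + 1) (by omega)⟩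
  · rintro ⟨h0, h⟩ (_ | k) hk
    · exact h0
    · exact h k (by omega)

theorem cylinder_zero (f : X → X) (i : ℕ → Set X) : cylinder f i 0 = i 0 := by
  simp [cylinder]

theorem antitone_cylinder (f : X → X) (i : ℕ → Set X) : Antitone (cylinder f i) :=
  fun _ _ h => biInter_subset_biInter_left fun _ hk => le_trans hk h

theorem mem_iInter_cylinder {i : ℕ → Set X} {x : X} :
    x ∈ ⋂ n, cylinder f i n ↔ ∀ n, f^[n] x ∈ i n := by
  simp only [cylinder, mem_iInter, mem_preimage]
  exact ⟨fun h n => h n n le_rfl, fun h _ k _ => h k⟩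

variable [TopologicalSpace X]

/-- By `cylinder_succ`, a cylinder is the pullback of a shorter one contained in `f '' i 0`, through
the homeomorphism from `i 0` onto that image. -/
theorem isConnected_cylinder {i : ℕ → Set X} (hi : ∀ n, IsConnected (i n))
    (hf : ∀ n, IsEmbedding ((i n).domRestrict f)) (hif : ∀ n, i (n + 1) ⊆ f '' i n) (n : ℕ) :
    IsConnected (cylinder f i n) := by
  induction n generalizing i with
  | zero => rw [cylinder_zero]; exact hi 0
  | succ n ih =>
    have hC := ih (i := fun k => i (k + 1)) (fun k => hi _) (fun k => hf _) fun k => hif _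
    have hsub : cylinder f (fun k => i (k + 1)) n ⊆ f '' i 0 := by
      refine Subset.trans (antitone_cylinder f _ n.zero_le) ?_
      rw [cylinder_zero]
      exact hif 0
    have h : IsConnected ((i 0).domRestrict f ⁻¹' cylinder f (fun k => i (k + 1)) n) := by
      have him : (i 0).domRestrict f '' ((i 0).domRestrict f ⁻¹' cylinder f (fun k => i (k + 1)) n) =
          cylinder f (fun k => i (k + 1)) n := by
        refine image_preimage_eq_of_subset ?_
        rwa [range_domRestrict]
      refine ⟨?_, ?_⟩
      · exact (image_nonempty (f := (i 0).domRestrict f)).1 (by rw [him]; exact hC.1)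
      · rw [← (hf 0).isInducing.isPreconnected_image, him]
        exact hC.2
    rw [cylinder_succ]
    have := h.image Subtype.val continuous_subtype_val.continuousOn
    convert this using 1
    ext x
    simp [domRestrict, and_comm]

theorem isClosed_cylinder {i : ℕ → Set X} (hi : ∀ n, IsClosed (i n)) (hf : Continuous f) (n : ℕ) :
    IsClosed (cylinder f i n) :=
  isClosed_biInter fun k _ => (hi k).preimage (hf.iterate k)

end Cylinders

/-! ### Consequences of mixing -/

section Mixing

variable {X : Type*} [TopologicalSpace X] {f : X → X}

/-- A countable open proper subset of a connected compact Hausdorff space is empty. -/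
theorem eq_empty_of_isOpen_of_countable [CompactSpace X] [T2Space X] [PreconnectedSpace X]
    {U : Set X} (hU : IsOpen U) (hc : U.Countable) (hne : Uᶜ.Nonempty) : U = ∅ := by
  by_contra h
  obtain ⟨x, hx⟩ := nonempty_iff_ne_empty.2 h
  obtain ⟨y, hy⟩ := hne
  obtain ⟨φ, h0, h1, -⟩ := exists_continuous_zero_one_of_isClosed (isClosed_singleton (x := x))
    hU.isClosed_compl (disjoint_singleton_left.2 (by simpa using hx))
  -- By connectedness the Urysohn function takes all values between 0 and 1, and those other than 1
  -- only inside `U`.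
  have hsub : Ioo (0 : ℝ) 1 ⊆ φ '' U := by
    intro t ht
    obtain ⟨z, hz⟩ : t ∈ range φ := (isPreconnected_range φ.continuous).Icc_subset
      ⟨x, h0 rfl⟩ ⟨y, h1 hy⟩ (Ioo_subset_Icc_self ht)
    refine ⟨z, ?_, hz⟩
    by_contra hzU
    exact ht.2.ne (hz.symm.trans (h1 hzU))
  exact Cardinal.Real.Ioo_countable_iff.not.2 (by norm_num) ((hc.image φ).mono hsub)

/-- An injective continuous map of an arc is not mixing. -/
theorem not_isTopMixing_of_homeomorph (e : unitInterval ≃ₜ X) (hf : Continuous f)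
    (hi : Function.Injective f) : ¬ IsTopMixing f := by
  intro hmix
  set g : unitInterval → unitInterval := e.symm ∘ f ∘ e with hg
  have hgc : Continuous g := e.symm.continuous.comp (hf.comp e.continuous)
  have hgi : Function.Injective g := e.symm.injective.comp (hi.comp e.injective)
  -- `g` may reverse orientation, but its square preserves it. One side of any interior point `c` is
  -- then invariant under the square, and even iterates contradict mixing.
  have hgg : StrictMono (g ∘ g) := by
    rcases hgc.strictMono_of_inj hgi with h | h
    · exact h.comp h
    · exact h.comp h
  have hconj : ∀ n t, f^[n] (e t) = e (g^[n] t) := fun n t =>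
    (Function.Semiconj.iterate_right (f := e) (ga := g) (gb := f) (fun t => by simp [hg]) n t).symm
  have key : ∀ U V : Set unitInterval, IsOpen U → U.Nonempty → IsOpen V → V.Nonempty →
      Disjoint U V → ¬ MapsTo (g ∘ g) U U := by
    intro U V hU hUn hV hVn hd hm
    obtain ⟨n, hn⟩ := hmix _ _ (e.isOpenMap U hU) (hUn.image e) (e.isOpenMap V hV) (hVn.image e)
    obtain ⟨_, ⟨_, ⟨t, ht, rfl⟩, rfl⟩, ⟨s, hs, hst⟩⟩ := hn (2 * n) (by omega)
    rw [hconj, Function.iterate_mul] at hst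
    rw [e.injective hst] at hs
    exact disjoint_left.1 hd (hm.iterate n ht) hs
  obtain ⟨c, hc0, hc1⟩ := exists_between (zero_lt_one (α := unitInterval))
  rcases le_total c (g (g c)) with h | h
  · exact key (Ioi c) (Iio c) isOpen_Ioi ⟨1, hc1⟩ isOpen_Iio ⟨0, hc0⟩
      (disjoint_left.2 fun x (hx : c < x) hx' => lt_asymm hx hx') fun x hx => h.trans_lt (hgg hx)
  · exact key (Iio c) (Ioi c) isOpen_Iio ⟨0, hc0⟩ isOpen_Ioi ⟨1, hc1⟩
      (disjoint_left.2 fun x (hx : x < c) hx' => lt_asymm hx hx') fun x hx => (hgg hx).trans_le h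

/-- The infinite partition provided by `IsCPM` need not be `P`, so the second arc comes from mixing.
If `P` were one arc, its open countable complement would be empty and `f` would be an injective map
of an arc. -/
theorem IsMarkovPartition.nontrivial [CompactSpace X] [T2Space X] [PreconnectedSpace X]
    {P : Set (Set X)} (hP : IsMarkovPartition f P) (hf : Continuous f) (hmix : IsTopMixing f)
    (hne : P.Nonempty) : P.Nontrivial := by
  obtain ⟨i, hi⟩ := hne
  by_contra hnt
  obtain rfl : P = {i} := (not_nontrivial_iff.1 hnt).eq_singleton_of_mem hi
  have hcover := hP.tame.cover
  rw [sUnion_singleton] at hcover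
  have harc := hP.tame.isArc hi
  have huniv : i = univ := by
    rw [← compl_empty_iff]
    exact eq_empty_of_isOpen_of_countable harc.isCompact.isClosed.isOpen_compl hcover
      (by simpa using harc.isConnected.nonempty)
  subst huniv
  obtain ⟨γ, hγ, hr⟩ := harc
  exact not_isTopMixing_of_homeomorph (hγ.toHomeomorphOfSurjective (range_eq_univ.1 hr)) hf
    (injOn_univ.1 (injOn_iff_injective.2 (hP.monotone _ hi).injective)) hmix

/-- An itinerary determines a unique point. -/
theorem IsMarkovPartition.exists_iInter_cylinder_eq [CompactSpace X] [T2Space X]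
    [PreconnectedSpace X] {P : Set (Set X)} (hP : IsMarkovPartition f P) (hf : Continuous f)
    (hmix : IsTopMixing f) {i : ℕ → Set X} (hi : ∀ n, i n ∈ P)
    (hif : ∀ n, i (n + 1) ⊆ f '' i n) : ∃ x, ⋂ n, cylinder f i n = {x} := by
  have harc := fun n => hP.tame.isArc (hi n)
  have hconn := isConnected_cylinder (fun n => (harc n).isConnected)
    (fun n => hP.monotone _ (hi n)) hif
  have hclosed := isClosed_cylinder (fun n => (harc n).isCompact.isClosed) hf
  obtain ⟨x, hx⟩ := IsCompact.nonempty_iInter_of_sequence_nonempty_isCompact_isClosed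
    (cylinder f i) (fun n => antitone_cylinder f i n.le_succ) (fun n => (hconn n).nonempty)
    (hclosed 0).isCompact hclosed
  refine ⟨x, eq_singleton_iff_unique_mem.2 ⟨hx, fun y hy => ?_⟩⟩
  by_contra hxy
  obtain ⟨γ, hγ, hr⟩ := harc 0
  have hcyl : ∀ n, cylinder f i n ⊆ range γ := fun n => by
    rw [hr, ← cylinder_zero f i]
    exact antitone_cylinder f i n.zero_le
  obtain ⟨s, t, hst, hs, ht⟩ : ∃ s t, s < t ∧ γ s ∈ ⋂ n, cylinder f i n ∧
      γ t ∈ ⋂ n, cylinder f i n := by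
    obtain ⟨s, rfl⟩ := hcyl 0 (mem_iInter.1 hx 0)
    obtain ⟨t, rfl⟩ := hcyl 0 (mem_iInter.1 hy 0)
    rcases lt_or_gt_of_ne (fun h : s = t => hxy (h ▸ rfl)) with h | h
    · exact ⟨s, t, h, hx, hy⟩
    · exact ⟨t, s, h, hy, hx⟩
  have hsub : γ '' Ioo s t ⊆ ⋂ n, cylinder f i n := by
    refine subset_iInter fun n => image_subset_iff.2 (Ioo_subset_Icc_self.trans ?_)
    have : IsPreconnected (γ ⁻¹' cylinder f i n) := by
      rw [← hγ.isInducing.isPreconnected_image, image_preimage_eq_of_subset (hcyl n)]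
      exact (hconn n).isPreconnected
    exact this.Icc_subset (mem_iInter.1 hs n) (mem_iInter.1 ht n)
  -- The interval is relatively open in the arc and avoids its ends; freeness of the arc makes it
  -- open in the space.
  have hopen : IsOpen (γ '' Ioo s t) := by
    obtain ⟨V, hV, hVst⟩ := hγ.isInducing.isOpen_iff.1 (isOpen_Ioo (a := s) (b := t))
    have h01 : Ioo s t ⊆ Ioo 0 1 := fun u hu =>
      ⟨unitInterval.nonneg'.trans_lt hu.1, hu.2.trans_le unitInterval.le_one'⟩
    have : γ '' Ioo s t = V ∩ arcInterior (i 0) := by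
      rw [← hr, arcInterior_range hγ, inter_comm, ← image_inter_preimage, hVst,
        inter_eq_right.2 h01]
    rw [this]
    exact hV.inter (hP.tame.freeArc _ (hi 0)).2
  obtain ⟨j, hj, k, hk, hjk⟩ := hP.nontrivial hf hmix ⟨_, hi 0⟩
  have key : ∀ l ∈ P, ∃ n, ∀ m ≥ n, i m = l := by
    intro l hl
    obtain ⟨n, hn⟩ := hmix _ _ hopen ((nonempty_Ioo.2 hst).image γ) (hP.tame.freeArc l hl).2
      (hP.tame.isArc hl).nonempty_arcInterior
    refine ⟨n, fun m hm => ?_⟩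
    obtain ⟨_, ⟨z, hz, rfl⟩, hzl⟩ := hn m hm
    exact hP.tame.eq_of_mem_arcInterior (hi m) hl (mem_iInter_cylinder.1 (hsub hz) m) hzl
  obtain ⟨a, ha⟩ := key j hj
  obtain ⟨b, hb⟩ := key k hk
  exact hjk ((ha _ (le_max_left a b)).symm.trans (hb _ (le_max_right a b)))

end Mixing

/-! ### The coding map and its inverse -/

section Coding

theorem MarkovShift.isOpen_preimage_coord {ι : Type*} (M : Matrix ι ι ℕ) (n : ℕ) (A : Set ι) :
    IsOpen {s : MarkovShift M | s.1 n ∈ A} :=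
  ⟨{s | s n ∈ A}, @IsOpen.preimage _ _ (@Pi.topologicalSpace ℕ (fun _ => ι) fun _ => ⊥) ⊥ _
    (@continuous_apply ℕ (fun _ => ι) (fun _ => ⊥) n) A trivial, rfl⟩

theorem MarkovShift.continuous_of_coord {ι Y : Type*} [TopologicalSpace Y] (M : Matrix ι ι ℕ)
    {g : Y → MarkovShift M} (hg : ∀ n a, IsOpen {y | (g y).1 n = a}) : Continuous g := by
  let _ : TopologicalSpace ι := ⊥
  refine continuous_induced_rng.2 (continuous_pi fun n => continuous_def.2 fun A _ => ?_)
  have hA : (fun y => (g y).1 n) ⁻¹' A = ⋃ a ∈ A, {y | (g y).1 n = a} := by ext; simp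
  exact hA ▸ isOpen_biUnion fun a _ => hg n a

variable {X : Type*} {f : X → X} {P : Set (Set X)}

theorem MarkovShift.subset_image (s : MarkovShift (transitionMatrix f P)) (n : ℕ) :
    (s.1 (n + 1) : Set X) ⊆ f '' (s.1 n : Set X) := by
  by_contra h
  simpa [transitionMatrix, h] using s.2 n

variable {ψ : MarkovShift (transitionMatrix f P) → X}

theorem coding_mem (hψ : ∀ s, ⋂ n, cylinder f (fun k => (s.1 k : Set X)) n = {ψ s})
    (s : MarkovShift (transitionMatrix f P)) (n : ℕ) : f^[n] (ψ s) ∈ (s.1 n : Set X) :=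
  mem_iInter_cylinder.1 ((hψ s).symm ▸ mem_singleton (ψ s)) n

theorem coding_eq (hψ : ∀ s, ⋂ n, cylinder f (fun k => (s.1 k : Set X)) n = {ψ s})
    {s : MarkovShift (transitionMatrix f P)} {x : X} (h : ∀ n, f^[n] x ∈ (s.1 n : Set X)) :
    ψ s = x := by
  have : x ∈ ⋂ n, cylinder f (fun k => (s.1 k : Set X)) n := mem_iInter_cylinder.2 h
  rw [hψ s] at this
  exact this.symm

theorem coding_shift (hψ : ∀ s, ⋂ n, cylinder f (fun k => (s.1 k : Set X)) n = {ψ s})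
    (s : MarkovShift (transitionMatrix f P)) : ψ (MarkovShift.shift _ s) = f (ψ s) :=
  coding_eq hψ fun n => coding_mem hψ s (n + 1)

variable [TopologicalSpace X]

theorem preimage_exceptionalSet_subset :
    f ⁻¹' exceptionalSet f P ⊆ exceptionalSet f P := by
  intro x hx
  obtain ⟨n, hn⟩ := mem_iUnion.1 hx
  exact mem_iUnion.2 ⟨n + 1, hn⟩

theorem notMem_exceptionalSet_iff {x : X} :
    x ∉ exceptionalSet f P ↔ ∀ n, ∃ i : P, f^[n] x ∈ arcInterior (i : Set X) := by
  simp [exceptionalSet, partitionPoints]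

/-- By compactness some cylinder of `s` already lies in the given neighbourhood, and all sequences
agreeing with `s` up to that length are coded into it. -/
theorem continuous_coding [CompactSpace X] [T2Space X] (hP : IsTamePartition P) (hf : Continuous f)
    (hψ : ∀ s, ⋂ n, cylinder f (fun k => (s.1 k : Set X)) n = {ψ s}) : Continuous ψ := by
  refine continuous_iff_continuousAt.2 fun s => ?_
  rw [ContinuousAt, tendsto_def]
  intro U hU
  have hcl := isClosed_cylinder (i := fun k => (s.1 k : Set X))
    (fun n => (hP.isArc (s.1 n).2).isCompact.isClosed) hf
  obtain ⟨n, hn⟩ := exists_subset_nhds_of_isCompact'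
    (antitone_cylinder f (fun k => (s.1 k : Set X))).directed_ge
    (fun n => (hcl n).isCompact) hcl (U := U) fun x hx => by
      rw [hψ s] at hx
      exact (show x = ψ s from hx) ▸ hU
  have hopen : IsOpen (⋂ k ∈ Finset.range (n + 1),
      {t : MarkovShift (transitionMatrix f P) | t.1 k ∈ ({s.1 k} : Set P)}) :=
    isOpen_biInter_finset fun k _ => MarkovShift.isOpen_preimage_coord _ k _
  refine mem_of_superset (hopen.mem_nhds (by simp)) fun t ht => hn ?_
  simp only [mem_iInter, Finset.mem_range, mem_ofPred_eq, mem_singleton_iff] at ht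
  simp only [cylinder, mem_iInter, mem_preimage]
  intro k hk
  rw [← ht k (by omega)]
  exact coding_mem hψ t k

/-- If the orbit is at a partition point at time `n`, the symbols `0, …, n` determine the sequence.
The point at time `m ≥ n` is an end of the current arc, so its image is an end of the image arc, and
only one partition arc inside that image contains it. -/
theorem countable_coding_preimage_singleton (hP : IsMarkovPartition f P)
    (hψ : ∀ s, ⋂ n, cylinder f (fun k => (s.1 k : Set X)) n = {ψ s}) {x : X}
    (hx : x ∈ exceptionalSet f P) : (ψ ⁻¹' {x}).Countable := by
  obtain ⟨n, hn⟩ := mem_iUnion.1 hx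
  have : Countable P := hP.tame.countable.to_subtype
  refine MapsTo.countable_of_injOn (f := fun s (k : Fin (n + 1)) => s.1 k) (mapsTo_univ _ _) ?_
    countable_univ
  rintro s rfl t (ht : ψ t = ψ s) hst
  have htx : ∀ m, f^[m] (ψ s) ∈ (t.1 m : Set X) := fun m => ht ▸ coding_mem hψ t m
  have hend : f^[n] (ψ s) ∈ arcEnds (s.1 n : Set X) := by
    by_contra h
    exact hn (mem_biUnion (s.1 n).2 ⟨coding_mem hψ s n, h⟩)
  have hle : ∀ m ≤ n, s.1 m = t.1 m := fun m hm => congrFun hst ⟨m, by omega⟩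
  have hge : ∀ m, n ≤ m → s.1 m = t.1 m ∧ f^[m] (ψ s) ∈ arcEnds (s.1 m : Set X) := by
    intro m hm
    induction m, hm using Nat.le_induction with
    | base => exact ⟨hle n le_rfl, hend⟩
    | succ m _ ih =>
      have him := image_arcEnds (hP.monotone _ (s.1 m).2) ih.2
      rw [← Function.iterate_succ_apply' f] at him
      have hs := s.subset_image m
      have ht' := t.subset_image m
      rw [← ih.1] at ht'
      exact ⟨Subtype.ext (hP.tame.eq_of_mem_arcEnds (s.1 (m + 1)).2 (t.1 (m + 1)).2 him hs ht'
        (coding_mem hψ s _) (htx _)),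
        mem_arcEnds_of_subset him (hP.tame.isArc (s.1 (m + 1)).2) hs (coding_mem hψ s _)⟩
  exact Subtype.ext (funext fun m => (le_total m n).elim (hle m) fun h => (hge m h).1)

theorem countable_coding_preimage_exceptionalSet (hP : IsMarkovPartition f P)
    (hψ : ∀ s, ⋂ n, cylinder f (fun k => (s.1 k : Set X)) n = {ψ s}) :
    (ψ ⁻¹' exceptionalSet f P).Countable := by
  rw [← biUnion_preimage_singleton]
  exact hP.countable_exceptionalSet.biUnion fun x hx => countable_coding_preimage_singleton hP hψ hx

/-- The itinerary of a point outside the exceptional set. -/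
theorem exists_itinerary (hP : IsMarkovPartition f P) {x : X} (hx : x ∉ exceptionalSet f P) :
    ∃ s : MarkovShift (transitionMatrix f P), ∀ n, f^[n] x ∈ arcInterior (s.1 n : Set X) := by
  choose i hi using notMem_exceptionalSet_iff.1 hx
  refine ⟨⟨i, fun n => ?_⟩, hi⟩
  rw [transitionMatrix, if_pos]
  refine hP.markov _ (i n).2 _ (i (n + 1)).2 ⟨f^[n + 1] x, ?_, hi (n + 1)⟩
  rw [Function.iterate_succ_apply']
  exact mem_image_of_mem f (hi n).1

theorem exists_coding_homeomorph [CompactSpace X] [T2Space X] (hP : IsMarkovPartition f P)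
    (hf : Continuous f) (hψ : ∀ s, ⋂ n, cylinder f (fun k => (s.1 k : Set X)) n = {ψ s}) :
    ∃ e : ↥((ψ ⁻¹' exceptionalSet f P)ᶜ) ≃ₜ ↥((exceptionalSet f P)ᶜ), ∀ s, (e s : X) = ψ s := by
  choose g hg using fun x : ↥((exceptionalSet f P)ᶜ) => exists_itinerary hP x.2
  have hψg : ∀ x, ψ (g x) = x := fun x => coding_eq hψ fun n => (hg x n).1
  have heq : ∀ (x : ↥((exceptionalSet f P)ᶜ)) n (j : P), f^[n] (x : X) ∈ (j : Set X) →
      j = (g x).1 n := fun x n j h =>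
    Subtype.ext (hP.tame.eq_of_mem_arcInterior j.2 ((g x).1 n).2 h (hg x n))
  have hinv : ∀ s (h : ψ s ∉ exceptionalSet f P), g ⟨ψ s, h⟩ = s := fun s h =>
    Subtype.ext (funext fun n => (heq ⟨ψ s, h⟩ n (s.1 n) (coding_mem hψ s n)).symm)
  -- Off `Q`, having `n`-th symbol `a` means exactly that the `n`-th iterate lies in the open
  -- interior of `a`.
  have hgc : Continuous g := by
    refine MarkovShift.continuous_of_coord _ fun n a => ?_
    convert (hP.tame.freeArc _ a.2).2.preimage ((hf.iterate n).comp continuous_subtype_val) using 1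
    ext x
    exact ⟨fun h => h ▸ hg x n, fun h => (heq x n a h.1).symm⟩
  exact ⟨{
    toFun := fun s => ⟨ψ s, s.2⟩
    invFun := fun x => ⟨g x, fun h => x.2 (hψg x ▸ h)⟩
    left_inv := fun s => Subtype.ext (hinv s s.2)
    right_inv := fun x => Subtype.ext (hψg x)
    continuous_toFun := ((continuous_coding hP.tame hf hψ).comp continuous_subtype_val).subtype_mk _
    continuous_invFun := hgc.subtype_mk _ }, fun _ => rfl⟩

end Coding

end TameGraph

open TameGraph in
theorem mainTheorem7 {G : Type u} [TopologicalSpace G] [MeasurableSpace G] [BorelSpace G]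
    (hG : TameGraph.IsTameGraph G) (f : G → G) (hf : TameGraph.IsCPM f)
    (P : Set (Set G)) (hP : TameGraph.IsMarkovPartition f P) :
    TameGraph.IsomorphicModSmallSets f
        (TameGraph.MarkovShift.shift (TameGraph.transitionMatrix f P)) ∧
      ∃ ψ : TameGraph.MarkovShift (TameGraph.transitionMatrix f P) → G,
        (∀ s, ⋂ n, TameGraph.cylinder f (fun k => (s.1 k : Set G)) n = {ψ s}) ∧
        (TameGraph.exceptionalSet f P).Countable ∧
        (ψ ⁻¹' TameGraph.exceptionalSet f P).Countable ∧
        ∃ e : ↥((ψ ⁻¹' TameGraph.exceptionalSet f P)ᶜ) ≃ᵐ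
            ↥((TameGraph.exceptionalSet f P)ᶜ),
          TameGraph.IsIsoModSmall
              (TameGraph.MarkovShift.shift (TameGraph.transitionMatrix f P)) f
              (ψ ⁻¹' TameGraph.exceptionalSet f P) (TameGraph.exceptionalSet f P) e ∧
            ∀ s, (e s : G) = ψ s := by
  have := hG.compact
  have := hG.connected
  have := hG.metrizable
  have hmap : ∀ s : MarkovShift (transitionMatrix f P),
      ∃ x, ⋂ n, cylinder f (fun k => (s.1 k : Set G)) n = {x} := fun s =>
    hP.exists_iInter_cylinder_eq hf.continuous hf.mixing (fun n => (s.1 n).2) s.subset_image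
  choose ψ hψ using hmap
  have hQ := hP.countable_exceptionalSet
  have hN := countable_coding_preimage_exceptionalSet hP hψ
  obtain ⟨e, he⟩ := exists_coding_homeomorph hP hf.continuous hψ
  have smallQ : IsSmall f (exceptionalSet f P) :=
    isSmall_of_countable hQ.measurableSet hQ preimage_exceptionalSet_subset
  have smallN : IsSmall (MarkovShift.shift (transitionMatrix f P)) (ψ ⁻¹' exceptionalSet f P) := by
    refine isSmall_of_countable
      ((continuous_coding hP.tame hf.continuous hψ).measurable hQ.measurableSet) hN fun s hs => ?_
    rw [mem_preimage, mem_preimage, coding_shift hψ] at hs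
    exact preimage_exceptionalSet_subset hs
  refine ⟨⟨_, _, e.toMeasurableEquiv.symm, smallQ, smallN, fun x y hxy => ?_⟩, ψ, hψ, hQ, hN,
    e.toMeasurableEquiv, ⟨smallN, smallQ, fun s t hst => ?_⟩, he⟩
  -- The first component uses the inverse of the coding, so its intertwining relation is obtained by
  -- applying the injective `e` to both sides; `hs` places the shifted sequence in the domain of
  -- `e`.
  · have hs : MarkovShift.shift _ (e.symm x : MarkovShift (transitionMatrix f P)) ∈
        (ψ ⁻¹' exceptionalSet f P)ᶜ := fun h => y.2 (by
      rw [mem_preimage, coding_shift hψ, ← he, e.apply_symm_apply, ← hxy] at h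
      exact h)
    have : (⟨_, hs⟩ : ↥((ψ ⁻¹' exceptionalSet f P)ᶜ)) = e.symm y := by
      refine e.injective (Subtype.ext ?_)
      rw [e.apply_symm_apply, he, coding_shift hψ, ← he, e.apply_symm_apply, hxy]
    exact congrArg Subtype.val this
  · change f (e s) = e t
    rw [he, he, hst, coding_shift hψ]
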